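/- Let $E$ be a locally compact Hausdorff space with a countable base, equipped with its Borel $\sigma$-algebra. Let $(\hat P_t)_{t\ge 0}$ be a Feller–Dynkin semigroup on $C_0(E)$ (a strongly continuous semigroup of bounded linear operators such that $0\le f\le 1$ implies $0\le \hat P_t f\le 1$), and let $(P_t)_{t\ge 0}$ be the sub-Markov kernels representing it, $\hat P_t f(x)=\int f(y)\,P_t(x,\mathrm dy)$; write $P_t(x)=P_t(x,\cdot)$. Suppose that the semigroup describes a diffusion: it is honest ($P_t(x,E)=1$ for all $t\ge 0$ and $x\in E$), its canonical process started at $x\in E$ has continuous trajectories, so that its law $\mathbb P^x$ is the probability measure on $C([0,\infty),E)$ (with the topology of uniform convergence on compact sets and the $\sigma$-algebra generated by the coordinates) that has initial state $x$ and the finite-dimensional distributions given by $(P_t)$, and $x\mapsto \mathbb P^x$ is weakly continuous. Let $obs:E\to[0,1]$ be continuous and let $0<c<1$. For a lower semicontinuous pseudometric $m:E\times E\to[0,1]$ put $$\mathcal F_c(m)(x,y)=\sup_{t\ge 0}c^t\,W(m)(P_t(x),P_t(y)),\qquad W(m)(\mu,\nu)=\inf_{\gamma\in\Gamma(\mu,\nu)}\int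 m\,\mathrm d\gamma,$$ where $\Gamma(\mu,\nu)$ is the set of couplings of $\mu$ and $\nu$. Define $\delta^c_0(x,y)=|obs(x)-obs(y)|$, $\delta^c_{n+1}=\mathcal F_c(\delta^c_n)$ for $n\ge 0$, and $\overline\delta^c=\sup_n\delta^c_n$. Theorem. Every $\delta^c_n$ is a pseudometric $E\times E\to[0,1]$ that is continuous for the original topology of $E$ (so the sequence is well defined), $\overline\delta^c$ is a lower semicontinuous pseudometric $E\times E\to[0,1]$ (so that $\mathcal F_c(\overline\delta^c)$ is defined), and $\overline\delta^c$ is a fixpoint of $\mathcal F_c$: $$\mathcal F_c(\overline\delta^c)=\overline\delta^c .$$ -/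

import Mathlib

open scoped NNReal ENNReal Topology ZeroAtInfty CompactlySupported BoundedContinuousFunction
open MeasureTheory ProbabilityTheory Filter

namespace BehaviouralMetric

/-- A Feller-Dynkin semigroup on `E`: a strongly continuous semigroup of bounded linear operators
on `C₀(E)` such that `0 ≤ f ≤ 1` implies `0 ≤ P̂ₜ f ≤ 1`. -/
structure FellerDynkinSemigroup (E : Type*) [TopologicalSpace E] where
  op : ℝ≥0 → C₀(E, ℝ) →L[ℝ] C₀(E, ℝ)
  op_zero : op 0 = ContinuousLinearMap.id ℝ C₀(E, ℝ)
  op_add : ∀ s t : ℝ≥0, op (s + t) = (op s).comp (op t)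
  strongly_continuous : ∀ f : C₀(E, ℝ), Tendsto (fun t => ‖op t f - f‖) (𝓝[>] 0) (𝓝 0)
  sub_markov : ∀ (t : ℝ≥0) (f : C₀(E, ℝ)), (∀ x, 0 ≤ f x ∧ f x ≤ 1) →
    ∀ x, 0 ≤ op t f x ∧ op t f x ≤ 1

namespace FellerDynkinSemigroup

section Kernel

variable {E : Type*} [TopologicalSpace E]

theorem op_nonneg (S : FellerDynkinSemigroup E) (t : ℝ≥0) (f : C₀(E, ℝ)) (hf : ∀ x, 0 ≤ f x)
    (x : E) : 0 ≤ S.op t f x := by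
  have hle : ∀ y, f y ≤ ‖f‖ := fun y =>
    (le_abs_self _).trans (f.toBCF.norm_coe_le_norm y)
  have hpos : 0 < ‖f‖ + 1 := by positivity
  have h := (S.sub_markov t ((‖f‖ + 1)⁻¹ • f) (fun y => by
    simp only [ZeroAtInftyContinuousMap.smul_apply, smul_eq_mul]
    refine ⟨mul_nonneg (by positivity) (hf y), ?_⟩
    rw [inv_mul_le_iff₀ hpos]
    linarith [hle y]) x).1
  rw [map_smul, ZeroAtInftyContinuousMap.smul_apply, smul_eq_mul] at h
  exact nonneg_of_mul_nonneg_right h (inv_pos.mpr hpos)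

/-- The positive linear functional `f ↦ (P̂ₜ f)(x)` on compactly supported continuous functions. -/
noncomputable def functional (S : FellerDynkinSemigroup E) (t : ℝ≥0) (x : E) :
    C_c(E, ℝ) →ₚ[ℝ] ℝ :=
  PositiveLinearMap.mk₀
    { toFun := fun f => S.op t (f : C₀(E, ℝ)) x
      map_add' := fun f g => by
        have h : ((f + g : C_c(E, ℝ)) : C₀(E, ℝ)) = (f : C₀(E, ℝ)) + (g : C₀(E, ℝ)) := rfl
        rw [h, map_add, ZeroAtInftyContinuousMap.add_apply]
      map_smul' := fun a f => by
        have h : ((a • f : C_c(E, ℝ)) : C₀(E, ℝ)) = a • (f : C₀(E, ℝ)) := rfl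
        rw [h, map_smul, ZeroAtInftyContinuousMap.smul_apply, RingHom.id_apply] }
    (fun f hf => S.op_nonneg t (f : C₀(E, ℝ)) hf x)

theorem functional_apply (S : FellerDynkinSemigroup E) (t : ℝ≥0) (x : E) (f : C_c(E, ℝ)) :
    S.functional t x f = S.op t (f : C₀(E, ℝ)) x := rfl

variable [T2Space E] [LocallyCompactSpace E] [MeasurableSpace E] [BorelSpace E]

/-- The measure `Pₜ(x, ·)` that represents `f ↦ (P̂ₜ f)(x)` (Riesz representation). -/
noncomputable def transition (S : FellerDynkinSemigroup E) (t : ℝ≥0) (x : E) : Measure E :=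
  RealRMK.rieszMeasure (S.functional t x)

theorem transition_univ_le_one (S : FellerDynkinSemigroup E) (t : ℝ≥0) (x : E) :
    S.transition t x Set.univ ≤ 1 := by
  have : (S.transition t x).Regular := RealRMK.regular_rieszMeasure (S.functional t x)
  rw [isOpen_univ.measure_eq_iSup_isCompact]
  refine iSup₂_le fun K _ => iSup_le fun hK => ?_
  obtain ⟨f, hf1, -, hfc, hf⟩ := exists_continuous_one_zero_of_isCompact hK isClosed_empty
    (Set.disjoint_empty K)
  let g : C_c(E, ℝ) := ⟨f, hfc⟩
  refine (RealRMK.rieszMeasure_le_of_eq_one (S.functional t x) (f := g) (fun y => (hf y).1) hK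
    (fun y hy => hf1 hy)).trans ?_
  rw [functional_apply, ← ENNReal.ofReal_one]
  exact ENNReal.ofReal_le_ofReal (S.sub_markov t (g : C₀(E, ℝ)) hf x).2

instance (S : FellerDynkinSemigroup E) (t : ℝ≥0) (x : E) : IsFiniteMeasure (S.transition t x) :=
  ⟨(S.transition_univ_le_one t x).trans_lt ENNReal.one_lt_top⟩

theorem measurable_transition [SecondCountableTopology E] (S : FellerDynkinSemigroup E)
    (t : ℝ≥0) : Measurable (S.transition t) := by
  have hK : ∀ K : Set E, IsCompact K → Measurable fun x => S.transition t x K := by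
    intro K hK
    let := TopologicalSpace.metrizableSpaceMetric E
    obtain ⟨f, hfK, -, hfc, hf⟩ := exists_continuous_one_zero_of_isCompact_of_isGδ hK
      hK.isClosed.isGδ isClosed_empty (Set.disjoint_empty K)
    let g : ℕ → C_c(E, ℝ) := fun n => ⟨f ^ (n + 1), by
      refine hfc.mono fun y hy hy0 => hy ?_
      simp [hy0]⟩
    have hlim : ∀ x, Tendsto (fun n => S.op t (g n : C₀(E, ℝ)) x) atTop
        (𝓝 ((S.transition t x).real K)) := by
      intro x
      have h1 : ∀ n, S.op t (g n : C₀(E, ℝ)) x = ∫ y, f y ^ (n + 1) ∂(S.transition t x) := by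
        intro n
        exact (RealRMK.integral_rieszMeasure (S.functional t x) (g n)).symm
      simp_rw [h1]
      rw [← integral_indicator_one hK.measurableSet]
      refine tendsto_integral_of_dominated_convergence (fun _ => 1)
        (fun n => (f.continuous.pow (n + 1)).aestronglyMeasurable) (integrable_const _)
        (fun n => ae_of_all _ fun y => ?_) (ae_of_all _ fun y => ?_)
      · rw [Real.norm_of_nonneg (pow_nonneg (hf y).1 _)]
        exact pow_le_one₀ (hf y).1 (hf y).2
      · by_cases hy : y ∈ K
        · have : f y = 1 := by rw [hfK] at hy; exact hy
          simp [this, hy]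
        · have hne : f y ≠ 1 := fun h => hy (by rw [hfK]; exact h)
          rw [Set.indicator_of_notMem hy]
          exact (tendsto_pow_atTop_nhds_zero_of_lt_one (hf y).1
            (lt_of_le_of_ne (hf y).2 hne)).comp (tendsto_add_atTop_nat 1)
    have hm : Measurable fun x => (S.transition t x).real K :=
      measurable_of_tendsto_metrizable
        (fun n => (map_continuous (S.op t (g n : C₀(E, ℝ)))).measurable)
        (tendsto_pi_nhds.mpr hlim)
    have h := hm.ennreal_ofReal
    have heq : (fun x => ENNReal.ofReal ((S.transition t x).real K)) =
        fun x => S.transition t x K := funext fun x => ofReal_measureReal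
    rwa [heq] at h
  have hF : ∀ F : Set E, IsClosed F → Measurable fun x => S.transition t x F := by
    intro F hF
    have h : ∀ x, S.transition t x F
        = ⨆ n, S.transition t x (F ∩ compactCovering E n) := by
      intro x
      have hmono : Monotone fun n => F ∩ compactCovering E n := fun a b hab =>
        Set.inter_subset_inter_right _ (compactCovering_subset E hab)
      rw [← hmono.measure_iUnion, ← Set.inter_iUnion, iUnion_compactCovering, Set.inter_univ]
    simp_rw [h]
    exact Measurable.iSup fun n => hK _ ((isCompact_compactCovering E n).inter_left hF)
  refine Measurable.measure_of_isPiSystem (S := {s | IsClosed s}) ?_ isPiSystem_isClosed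
    (fun s hs => hF s hs) (hF _ isClosed_univ)
  rw [← borel_eq_generateFrom_isClosed]
  exact BorelSpace.measurable_eq

/-- The sub-Markov kernel `Pₜ` of a Feller-Dynkin semigroup. -/
noncomputable def kernel [SecondCountableTopology E] (S : FellerDynkinSemigroup E) (t : ℝ≥0) :
    Kernel E E where
  toFun := S.transition t
  measurable' := S.measurable_transition t

end Kernel

end FellerDynkinSemigroup

section Trajectories

variable {E : Type*} [TopologicalSpace E] [MeasurableSpace E]

/-- The σ-algebra on continuous trajectories generated by the coordinates `ω ↦ ω s`. The topology
on continuous trajectories is Mathlib's compact-open topology. -/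
instance trajectoryMeasurableSpace : MeasurableSpace C(ℝ≥0, E) :=
  ⨆ s : ℝ≥0, MeasurableSpace.comap (fun ω : C(ℝ≥0, E) => ω s) inferInstance

/-- `pathCylinder t [(s₁, B₁), …, (sₙ, Bₙ)]` is the set of trajectories `ω` with
`ω (t + s₁) ∈ B₁`, `ω (t + s₁ + s₂) ∈ B₂`, …, `ω (t + s₁ + ⋯ + sₙ) ∈ Bₙ`. -/
def pathCylinder (t : ℝ≥0) : List (ℝ≥0 × Set E) → Set C(ℝ≥0, E)
  | [] => Set.univ
  | (s, B) :: l => {ω | ω (t + s) ∈ B} ∩ pathCylinder (t + s) l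

/-- `pathCylinderMass P [(s₁, B₁), …, (sₙ, Bₙ)] x` is the iterated integral
`∫_{B₁} P_{s₁}(x, dx₁) ∫_{B₂} P_{s₂}(x₁, dx₂) ⋯ ∫_{Bₙ} P_{sₙ}(xₙ₋₁, dxₙ)`. -/
noncomputable def pathCylinderMass (P : ℝ≥0 → Kernel E E) : List (ℝ≥0 × Set E) → E → ℝ≥0∞
  | [], _ => 1
  | (s, B) :: l, x => ∫⁻ y in B, pathCylinderMass P l y ∂(P s x)

end Trajectories

section Diffusions

variable {E : Type*} [TopologicalSpace E] [T2Space E] [LocallyCompactSpace E]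
  [SecondCountableTopology E] [MeasurableSpace E] [BorelSpace E]

/-- A Feller-Dynkin semigroup describes a diffusion when it is honest (no loss of mass), its
canonical process started at `x` is carried by continuous trajectories, with law `Q x`, and
`x ↦ Q x` is weakly continuous. The law `Q x` is the one with the finite-dimensional
distributions prescribed by the kernels and the initial state `x` (times are given through their
nonnegative increments, and `P₀(x) = δₓ`). -/
structure IsDiffusion (S : FellerDynkinSemigroup E) : Prop where
  honest : ∀ (t : ℝ≥0) (x : E), S.kernel t x Set.univ = 1
  exists_law : ∃ Q : E → Measure C(ℝ≥0, E),
    (∀ x, IsProbabilityMeasure (Q x)) ∧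
    (∀ (x : E) (l : List (ℝ≥0 × Set E)), (∀ q ∈ l, MeasurableSet q.2) →
      Q x (pathCylinder 0 l) = pathCylinderMass S.kernel l x) ∧
    (∀ f : C(ℝ≥0, E) →ᵇ ℝ, Continuous fun x => ∫ ω, f ω ∂(Q x))

/-- The couplings of two measures. -/
def couplings (μ ν : Measure E) : Set (Measure (E × E)) :=
  {γ | IsProbabilityMeasure γ ∧ γ.fst = μ ∧ γ.snd = ν}

/-- The optimal transport cost `W(m)(μ, ν)`. -/
noncomputable def transportCost (m : E → E → ℝ) (μ ν : Measure E) : ℝ :=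
  ⨅ γ : couplings μ ν, ∫ p, m p.1 p.2 ∂(γ : Measure (E × E))

/-- The functional `F_c(m)(x, y) = sup_{t ≥ 0} c ^ t * W(m)(Pₜ(x), Pₜ(y))`. -/
noncomputable def discountedFunctional (S : FellerDynkinSemigroup E) (c : ℝ) (m : E → E → ℝ) :
    E → E → ℝ :=
  fun x y => ⨆ t : ℝ≥0, c ^ (t : ℝ) * transportCost m (S.kernel t x) (S.kernel t y)

/-- The sequence `δ₀(x, y) = |obs x - obs y|`, `δₙ₊₁ = F_c(δₙ)`. -/
noncomputable def iterMetric (S : FellerDynkinSemigroup E) (obs : C(E, Set.Icc (0 : ℝ) 1))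
    (c : ℝ) : ℕ → E → E → ℝ
  | 0 => fun x y => |(obs x : ℝ) - obs y|
  | n + 1 => discountedFunctional S c (iterMetric S obs c n)

/-- The behavioural pseudometric `sup_n δₙ`. -/
noncomputable def behaviouralMetric (S : FellerDynkinSemigroup E)
    (obs : C(E, Set.Icc (0 : ℝ) 1)) (c : ℝ) : E → E → ℝ :=
  fun x y => ⨆ n : ℕ, iterMetric S obs c n x y

end Diffusions

section Pseudometrics

/-- 1-bounded pseudometrics. -/
structure IsOneBoundedPseudometric {E : Type*} (m : E → E → ℝ) : Prop where
  nonneg : ∀ x y, 0 ≤ m x y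
  le_one : ∀ x y, m x y ≤ 1
  self : ∀ x, m x x = 0
  symm : ∀ x y, m x y = m y x
  triangle : ∀ x y z, m x z ≤ m x y + m y z

/-- The lattice `𝒫` of lower semicontinuous 1-bounded pseudometrics. -/
def IsLscPseudometric {E : Type*} [TopologicalSpace E] (m : E → E → ℝ) : Prop :=
  IsOneBoundedPseudometric m ∧ LowerSemicontinuous fun p : E × E => m p.1 p.2

/-- The lattice `𝒞` of continuous 1-bounded pseudometrics. -/
def IsContinuousPseudometric {E : Type*} [TopologicalSpace E] (m : E → E → ℝ) : Prop :=
  IsOneBoundedPseudometric m ∧ Continuous fun p : E × E => m p.1 p.2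

end Pseudometrics

end BehaviouralMetric

namespace BehaviouralMetric

/-! Since P₀(x) is the Dirac mass at x, the term t = 0 gives m ≤ F_c(m). Hence the iterates increase
and their supremum δ satisfies δ ≤ F_c(δ). The converse needs W(sup δₙ) ≤ sup W(δₙ), which is
`transportCost_iSup_le`: near-optimal couplings for δₙ have a limit coupling by tightness; for fixed
k the cost δ_k ≤ δₙ passes to that limit because δ_k is bounded and continuous, and monotone
convergence in k finishes.

This argument needs every δₙ to be continuous, which is
`isContinuousPseudometric_discountedFunctional`. The discount makes large times negligible. On a
compact time interval, joint continuity of (t, x) ↦ P̂ₜ f(x) shows that Pₜ(x) and Pₜ(y) share almost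
all their mass on bumps of small m-diameter, so that `transportCost_le_of_bumps` bounds their
transport cost. The triangle inequality for W comes from gluing couplings (`exists_gluing`). -/

/-! ### Standard Borel structure of the state space. -/

theorem standardBorelSpace_of_measurableEquiv {α β : Type*} [MeasurableSpace α]
    [MeasurableSpace β] [StandardBorelSpace β] (e : α ≃ᵐ β) : StandardBorelSpace α := by
  let := upgradeStandardBorel β
  let τ : TopologicalSpace α := TopologicalSpace.induced e inferInstance
  have hP : PolishSpace α := e.toEquiv.polishSpace_induced
  refine ⟨τ, ⟨?_⟩, hP⟩
  refine Eq.trans ?_ (borel_comap (f := e)).symm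
  rw [← BorelSpace.measurable_eq (α := β)]
  exact e.measurableEmbedding.comap_eq.symm

/-- The space is σ-compact, so its image in a metric completion is a countable union of compact
sets, hence a Borel subset of a Polish space. This supplies the disintegrations used for gluing. -/
theorem standardBorelSpace_of_locallyCompact (E : Type*) [TopologicalSpace E] [T2Space E]
    [LocallyCompactSpace E] [SecondCountableTopology E] [MeasurableSpace E] [BorelSpace E] :
    StandardBorelSpace E := by
  let := TopologicalSpace.metrizableSpaceMetric E
  let : MeasurableSpace (UniformSpace.Completion E) := borel _
  have : BorelSpace (UniformSpace.Completion E) := ⟨rfl⟩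
  have hemb : Topology.IsEmbedding ((↑) : E → UniformSpace.Completion E) :=
    UniformSpace.Completion.isUniformEmbedding_coe E |>.isEmbedding
  have hrange : MeasurableSet (Set.range ((↑) : E → UniformSpace.Completion E)) := by
    rw [← Set.image_univ, ← iUnion_compactCovering, Set.image_iUnion]
    exact MeasurableSet.iUnion fun n =>
      ((isCompact_compactCovering E n).image hemb.continuous).isClosed.measurableSet
  have : PolishSpace (UniformSpace.Completion E) := inferInstance
  have := hrange.standardBorel
  exact standardBorelSpace_of_measurableEquiv (hemb.measurableEmbedding hrange).equivRange

/-! ### Couplings: gluing and completion of partial couplings. -/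

section Couplings

variable {E : Type*} [MeasurableSpace E]

theorem prod_mem_couplings (μ ν : Measure E) [IsProbabilityMeasure μ] [IsProbabilityMeasure ν] :
    μ.prod ν ∈ couplings μ ν :=
  ⟨inferInstance, by simp, by simp⟩

theorem diagonal_mem_couplings (μ : Measure E) [IsProbabilityMeasure μ] :
    μ.map (fun x => (x, x)) ∈ couplings μ μ := by
  refine ⟨Measure.isProbabilityMeasure_map (by fun_prop), ?_, ?_⟩
  · rw [Measure.fst, Measure.map_map (by fun_prop) (by fun_prop)]
    exact Measure.map_id
  · rw [Measure.snd, Measure.map_map (by fun_prop) (by fun_prop)]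
    exact Measure.map_id

theorem swap_mem_couplings {μ ν : Measure E} {γ : Measure (E × E)} (hγ : γ ∈ couplings μ ν) :
    γ.map Prod.swap ∈ couplings ν μ := by
  obtain ⟨h, h1, h2⟩ := hγ
  refine ⟨Measure.isProbabilityMeasure_map (by fun_prop), ?_, ?_⟩
  · rw [Measure.fst_map_swap, h2]
  · rw [Measure.snd_map_swap, h1]

/-- The gluing lemma: couplings of `(μ, ν)` and `(ν, ρ)` are the two-dimensional marginals of a
measure on triples. -/
theorem exists_gluing [StandardBorelSpace E] {μ ν ρ : Measure E} {γ₁ γ₂ : Measure (E × E)}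
    (h₁ : γ₁ ∈ couplings μ ν) (h₂ : γ₂ ∈ couplings ν ρ) :
    ∃ π : Measure (E × E × E), IsProbabilityMeasure π ∧
      π.map (fun p => (p.2.1, p.1)) = γ₁ ∧ π.map (fun p => (p.1, p.2.2)) = γ₂ := by
  obtain ⟨hp₁, h₁f, h₁s⟩ := h₁
  obtain ⟨hp₂, h₂f, h₂s⟩ := h₂
  have hne : Nonempty E := by
    have := γ₁.nonempty_of_neZero
    exact this.map Prod.fst
  have hps : IsProbabilityMeasure (γ₁.map Prod.swap) :=
    Measure.isProbabilityMeasure_map (by fun_prop)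
  have hν : IsProbabilityMeasure ν := by rw [← h₂f]; infer_instance
  have d₁ := (γ₁.map Prod.swap).disintegrate (γ₁.map Prod.swap).condKernel
  have d₂ := γ₂.disintegrate γ₂.condKernel
  rw [Measure.fst_map_swap, h₁s] at d₁
  rw [h₂f] at d₂
  set κ := (γ₁.map Prod.swap).condKernel
  set η := γ₂.condKernel
  -- The shared coordinate comes first; given it, the two outer coordinates are drawn independently
  -- from the conditional laws.
  refine ⟨ν ⊗ₘ (κ ×ₖ η), inferInstance, ?_, ?_⟩
  · have : (ν ⊗ₘ (κ ×ₖ η)).map (fun p : E × E × E => (p.1, p.2.1)) = ν ⊗ₘ κ := by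
      have := Measure.compProd_map (μ := ν) (κ := κ ×ₖ η) (f := Prod.fst) measurable_fst
      rw [← Kernel.fst_eq, Kernel.fst_prod] at this
      exact this.symm
    have h3 : (fun p : E × E × E => (p.2.1, p.1)) = Prod.swap ∘ fun p : E × E × E => (p.1, p.2.1) :=
      rfl
    rw [h3, ← Measure.map_map (by fun_prop) (by fun_prop), this, d₁,
      Measure.map_map (by fun_prop) (by fun_prop), Prod.swap_swap_eq, Measure.map_id]
  · have := Measure.compProd_map (μ := ν) (κ := κ ×ₖ η) (f := Prod.snd) measurable_snd
    rw [← Kernel.snd_eq, Kernel.snd_prod, d₂] at this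
    exact this.symm

theorem fst_finset_sum {ι : Type*} (s : Finset ι) (γ : ι → Measure (E × E)) :
    (∑ i ∈ s, γ i).fst = ∑ i ∈ s, (γ i).fst := by
  ext A hA
  simp [Measure.fst_apply hA]

theorem snd_finset_sum {ι : Type*} (s : Finset ι) (γ : ι → Measure (E × E)) :
    (∑ i ∈ s, γ i).snd = ∑ i ∈ s, (γ i).snd := by
  ext A hA
  simp [Measure.snd_apply hA]

/-- A measure whose marginals are dominated by `μ` and `ν` extends to a coupling. -/
theorem exists_coupling_of_le {μ ν : Measure E} [IsProbabilityMeasure μ] [IsProbabilityMeasure ν]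
    {γ : Measure (E × E)} (h₁ : γ.fst ≤ μ) (h₂ : γ.snd ≤ ν) :
    ∃ ρ : Measure (E × E), γ + ρ ∈ couplings μ ν := by
  have hf : IsFiniteMeasure γ.fst := isFiniteMeasure_of_le μ h₁
  have hs : IsFiniteMeasure γ.snd := isFiniteMeasure_of_le ν h₂
  have hf1 : (μ - γ.fst) Set.univ = 1 - γ Set.univ := by
    rw [Measure.sub_apply MeasurableSet.univ h₁, measure_univ, Measure.fst_univ]
  have hs1 : (ν - γ.snd) Set.univ = 1 - γ Set.univ := by
    rw [Measure.sub_apply MeasurableSet.univ h₂, measure_univ, Measure.snd_univ]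
  set r : ℝ≥0∞ := 1 - γ Set.univ with hr
  have hr_top : r ≠ ∞ := ne_top_of_le_ne_top ENNReal.one_ne_top tsub_le_self
  -- Both defects have the same mass r, so their product divided by r has them as marginals. If r =
  -- 0 the factor r⁻¹ * r is 0 rather than 1, but then the defects vanish.
  have key : ∀ τ : Measure E, τ Set.univ = r → (r⁻¹ * r) • τ = τ := by
    intro τ hτ
    rcases eq_or_ne r 0 with h0 | h0
    · rw [h0, Measure.measure_univ_eq_zero] at hτ
      simp [hτ]
    · rw [ENNReal.inv_mul_cancel h0 hr_top, one_smul]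
  have e1 : (γ + r⁻¹ • (μ - γ.fst).prod (ν - γ.snd)).fst = μ := by
    rw [Measure.fst_add, Measure.fst.eq_1 (r⁻¹ • _), Measure.map_smul, Measure.map_fst_prod, hs1,
      smul_smul, key _ hf1, add_comm,
      Measure.sub_add_cancel_of_le h₁]
  have e2 : (γ + r⁻¹ • (μ - γ.fst).prod (ν - γ.snd)).snd = ν := by
    rw [Measure.snd_add, Measure.snd.eq_1 (r⁻¹ • _), Measure.map_smul, Measure.map_snd_prod, hf1,
      smul_smul, key _ hs1, add_comm,
      Measure.sub_add_cancel_of_le h₂]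
  refine ⟨_, ⟨?_⟩, e1, e2⟩
  rw [← Measure.fst_univ, e1, measure_univ]

end Couplings

/-! ### The transport cost as a pseudometric, and an upper bound by bumps. -/

section TransportCost

variable {E : Type*} [MeasurableSpace E] {m : E → E → ℝ}

theorem IsOneBoundedPseudometric.integrable (hm : IsOneBoundedPseudometric m)
    (hmeas : Measurable fun p : E × E => m p.1 p.2) {Ω : Type*} [MeasurableSpace Ω]
    (γ : Measure Ω) [IsFiniteMeasure γ] {f g : Ω → E} (hf : Measurable f) (hg : Measurable g) :
    Integrable (fun ω => m (f ω) (g ω)) γ :=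
  Integrable.of_bound (hmeas.comp (hf.prodMk hg)).aestronglyMeasurable 1
    (ae_of_all _ fun ω => by
      rw [Real.norm_of_nonneg (hm.nonneg _ _)]
      exact hm.le_one _ _)

theorem transportCost_nonneg (hm : IsOneBoundedPseudometric m) (μ ν : Measure E) :
    0 ≤ transportCost m μ ν :=
  Real.iInf_nonneg fun _ => integral_nonneg fun _ => hm.nonneg _ _

theorem transportCost_le_integral (hm : IsOneBoundedPseudometric m) {μ ν : Measure E}
    {γ : Measure (E × E)} (hγ : γ ∈ couplings μ ν) :
    transportCost m μ ν ≤ ∫ p, m p.1 p.2 ∂γ :=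
  ciInf_le (f := fun γ : couplings μ ν => ∫ p, m p.1 p.2 ∂(γ : Measure (E × E)))
    ⟨0, by rintro _ ⟨_, rfl⟩; exact integral_nonneg fun _ => hm.nonneg _ _⟩ ⟨γ, hγ⟩

theorem le_transportCost {μ ν : Measure E} [IsProbabilityMeasure μ] [IsProbabilityMeasure ν]
    {a : ℝ} (h : ∀ γ ∈ couplings μ ν, a ≤ ∫ p, m p.1 p.2 ∂γ) : a ≤ transportCost m μ ν := by
  have : Nonempty (couplings μ ν) := ⟨⟨_, prod_mem_couplings μ ν⟩⟩
  exact le_ciInf fun γ => h γ γ.2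

theorem exists_coupling_integral_lt {μ ν : Measure E} [IsProbabilityMeasure μ]
    [IsProbabilityMeasure ν] {a : ℝ} (h : transportCost m μ ν < a) :
    ∃ γ ∈ couplings μ ν, ∫ p, m p.1 p.2 ∂γ < a := by
  have : Nonempty (couplings μ ν) := ⟨⟨_, prod_mem_couplings μ ν⟩⟩
  obtain ⟨γ, hγ⟩ := exists_lt_of_ciInf_lt h
  exact ⟨γ, γ.2, hγ⟩

theorem transportCost_le_one (hm : IsOneBoundedPseudometric m)
    (hmeas : Measurable fun p : E × E => m p.1 p.2) (μ ν : Measure E) [IsProbabilityMeasure μ]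
    [IsProbabilityMeasure ν] : transportCost m μ ν ≤ 1 := by
  refine (transportCost_le_integral hm (prod_mem_couplings μ ν)).trans ?_
  refine (integral_mono (hm.integrable hmeas _ measurable_fst measurable_snd)
    (integrable_const (1 : ℝ)) fun p => hm.le_one p.1 p.2).trans ?_
  simp

theorem transportCost_self (hm : IsOneBoundedPseudometric m)
    (hmeas : Measurable fun p : E × E => m p.1 p.2) (μ : Measure E) [IsProbabilityMeasure μ] :
    transportCost m μ μ = 0 := by
  refine le_antisymm ?_ (transportCost_nonneg hm μ μ)
  refine (transportCost_le_integral hm (diagonal_mem_couplings μ)).trans ?_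
  rw [integral_map (by fun_prop) hmeas.aestronglyMeasurable]
  simp [hm.self]

theorem transportCost_comm_le (hm : IsOneBoundedPseudometric m)
    (hmeas : Measurable fun p : E × E => m p.1 p.2) (μ ν : Measure E) [IsProbabilityMeasure μ]
    [IsProbabilityMeasure ν] : transportCost m μ ν ≤ transportCost m ν μ := by
  refine le_transportCost fun γ hγ => ?_
  refine (transportCost_le_integral hm (swap_mem_couplings hγ)).trans ?_
  rw [integral_map (by fun_prop) hmeas.aestronglyMeasurable]
  simp [hm.symm]

theorem transportCost_triangle [StandardBorelSpace E] (hm : IsOneBoundedPseudometric m)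
    (hmeas : Measurable fun p : E × E => m p.1 p.2) (μ ν ρ : Measure E) [IsProbabilityMeasure μ]
    [IsProbabilityMeasure ν] [IsProbabilityMeasure ρ] :
    transportCost m μ ρ ≤ transportCost m μ ν + transportCost m ν ρ := by
  rw [← sub_le_iff_le_add]
  refine le_transportCost fun γ₁ h₁ => ?_
  rw [sub_le_comm]
  refine le_transportCost fun γ₂ h₂ => ?_
  rw [sub_le_iff_le_add]
  obtain ⟨π, hπ, e₁, e₂⟩ := exists_gluing h₁ h₂
  have hmem : π.map (fun p => (p.2.1, p.2.2)) ∈ couplings μ ρ := by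
    refine ⟨Measure.isProbabilityMeasure_map (by fun_prop), ?_, ?_⟩
    · rw [← h₁.2.1, ← e₁, Measure.fst, Measure.fst, Measure.map_map (by fun_prop) (by fun_prop),
        Measure.map_map (by fun_prop) (by fun_prop)]
      rfl
    · rw [← h₂.2.2, ← e₂, Measure.snd, Measure.snd, Measure.map_map (by fun_prop) (by fun_prop),
        Measure.map_map (by fun_prop) (by fun_prop)]
      rfl
  refine (transportCost_le_integral hm hmem).trans ?_
  rw [← e₁, ← e₂, integral_map (by fun_prop) hmeas.aestronglyMeasurable,
    integral_map (by fun_prop) hmeas.aestronglyMeasurable,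
    integral_map (by fun_prop) hmeas.aestronglyMeasurable, ← integral_add
      (hm.integrable hmeas π (by fun_prop) (by fun_prop))
      (hm.integrable hmeas π (by fun_prop) (by fun_prop))]
  refine integral_mono (hm.integrable hmeas π (by fun_prop) (by fun_prop))
    ((hm.integrable hmeas π (by fun_prop) (by fun_prop)).add
      (hm.integrable hmeas π (by fun_prop) (by fun_prop))) fun p => ?_
  exact (hm.triangle p.2.1 p.1 p.2.2).trans_eq (add_comm _ _)

theorem ae_eq_of_mem_couplings_dirac [MeasurableSingletonClass E] {x y : E} {γ : Measure (E × E)}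
    (hγ : γ ∈ couplings (Measure.dirac x) (Measure.dirac y)) : ∀ᵐ p ∂γ, p = (x, y) := by
  obtain ⟨-, h1, h2⟩ := hγ
  have a1 : ∀ᵐ p ∂γ, p.1 = x := by
    refine ae_of_ae_map (f := Prod.fst) measurable_fst.aemeasurable (p := fun z => z = x) ?_
    rw [← Measure.fst, h1, ae_dirac_eq]
    rfl
  have a2 : ∀ᵐ p ∂γ, p.2 = y := by
    refine ae_of_ae_map (f := Prod.snd) measurable_snd.aemeasurable (p := fun z => z = y) ?_
    rw [← Measure.snd, h2, ae_dirac_eq]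
    rfl
  filter_upwards [a1, a2] with p h h' using Prod.ext h h'

/-- Any coupling of two Dirac masses is concentrated at the single pair, so every admissible cost
equals m x y. -/
theorem le_transportCost_dirac [MeasurableSingletonClass E] (x y : E) :
    m x y ≤ transportCost m (Measure.dirac x) (Measure.dirac y) := by
  refine le_transportCost fun γ hγ => ?_
  have := hγ.1
  rw [integral_congr_ae (g := fun _ => m x y)
    ((ae_eq_of_mem_couplings_dirac hγ).mono fun p hp => by simp [hp])]
  simp

/-- If bump functions with small `m`-diameter have comparable integrals against `μ` and `ν`, and
carry most of the mass, then the transport cost is small. -/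
theorem transportCost_le_of_bumps (hm : IsOneBoundedPseudometric m)
    (hmeas : Measurable fun p : E × E => m p.1 p.2) (μ ν : Measure E) [IsProbabilityMeasure μ]
    [IsProbabilityMeasure ν] {ι : Type*} [Fintype ι] {f : ι → E → ℝ≥0∞}
    (hf : ∀ i, Measurable (f i)) (hsum : ∀ x, ∑ i, f i x ≤ 1) {ε : ℝ} (hε : 0 ≤ ε)
    (hdiam : ∀ i x y, f i x ≠ 0 → f i y ≠ 0 → m x y ≤ ε) :
    transportCost m μ ν ≤
      ε + (1 - ∑ i, min (∫⁻ x, f i x ∂μ) (∫⁻ x, f i x ∂ν)).toReal := by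
  set p : ι → ℝ≥0∞ := fun i => ∫⁻ x, f i x ∂μ with hp
  set q : ι → ℝ≥0∞ := fun i => ∫⁻ x, f i x ∂ν with hq
  have hle1 : ∀ (τ : Measure E) [IsProbabilityMeasure τ] (i : ι), ∫⁻ x, f i x ∂τ ≤ 1 := by
    intro τ _ i
    calc ∫⁻ x, f i x ∂τ ≤ ∫⁻ _, 1 ∂τ := lintegral_mono fun x =>
          (Finset.single_le_sum (f := fun i => f i x) (fun _ _ => zero_le)
            (Finset.mem_univ i)).trans (hsum x)
      _ = 1 := by simp
  have hfin : ∀ (τ : Measure E) [IsProbabilityMeasure τ] (i : ι),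
      IsFiniteMeasure (τ.withDensity (f i)) := fun τ _ i =>
    isFiniteMeasure_withDensity ((hle1 τ i).trans_lt ENNReal.one_lt_top).ne
  have hfμ := hfin μ
  have hfν := hfin ν
  have hdens : ∀ τ : Measure E, ∑ i, τ.withDensity (f i) ≤ τ := by
    intro τ
    refine Measure.le_iff.2 fun A hA => ?_
    rw [Measure.finsetSum_apply]
    simp_rw [withDensity_apply _ hA]
    rw [← lintegral_finsetSum _ fun i _ => hf i]
    calc ∫⁻ x in A, ∑ i, f i x ∂τ ≤ ∫⁻ _ in A, 1 ∂τ := lintegral_mono fun x => hsum x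
      _ = τ A := by simp
  have hpu : ∀ i, μ.withDensity (f i) Set.univ = p i := fun i => by simp [p]
  have hqu : ∀ i, ν.withDensity (f i) Set.univ = q i := fun i => by simp [q]
  -- Dividing the product by the larger of the two masses keeps both marginals below the reweighted
  -- measures and leaves total mass pq / max(p, q) = min(p, q). Each piece lives on pairs seen by
  -- one bump, where m ≤ ε.
  set γ : ι → Measure (E × E) := fun i =>
    (max (p i) (q i))⁻¹ • (μ.withDensity (f i)).prod (ν.withDensity (f i)) with hγ
  have hfst : ∀ i, (γ i).fst ≤ μ.withDensity (f i) := by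
    intro i
    rw [hγ, Measure.fst, Measure.map_smul, Measure.map_fst_prod, hqu, smul_smul]
    refine Measure.le_iff.2 fun A _ => ?_
    rw [Measure.smul_apply, smul_eq_mul]
    refine mul_le_of_le_one_left' ?_
    exact (mul_le_mul_right (le_max_right _ _) _).trans (ENNReal.inv_mul_le_one _)
  have hsnd : ∀ i, (γ i).snd ≤ ν.withDensity (f i) := by
    intro i
    rw [hγ, Measure.snd, Measure.map_smul, Measure.map_snd_prod, hpu, smul_smul]
    refine Measure.le_iff.2 fun A _ => ?_
    rw [Measure.smul_apply, smul_eq_mul]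
    refine mul_le_of_le_one_left' ?_
    exact (mul_le_mul_right (le_max_left _ _) _).trans (ENNReal.inv_mul_le_one _)
  have hmass : ∀ i, γ i Set.univ = min (p i) (q i) := by
    intro i
    rw [hγ, Measure.smul_apply, ← Set.univ_prod_univ, Measure.prod_prod, hpu, hqu, smul_eq_mul,
      ← max_mul_min (p i) (q i), ← mul_assoc]
    rcases eq_or_ne (max (p i) (q i)) 0 with h0 | h0
    · have : min (p i) (q i) = 0 := le_antisymm (min_le_max.trans h0.le) zero_le
      simp [this]
    · rw [ENNReal.inv_mul_cancel h0 (ne_top_of_le_ne_top ENNReal.one_ne_top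
        (max_le (hle1 μ i) (hle1 ν i))), one_mul]
  have hdiam' : ∀ i, ∀ᵐ z ∂(γ i), m z.1 z.2 ≤ ε := by
    intro i
    have hms : MeasurableSet {z : E × E | m z.1 z.2 ≤ ε} := measurableSet_le hmeas measurable_const
    refine Measure.ae_smul_measure ?_ _
    have hne : ∀ τ : Measure E, ∀ᵐ x ∂(τ.withDensity (f i)), f i x ≠ 0 := fun τ =>
      (ae_withDensity_iff (hf i)).2 (ae_of_all _ fun _ h => h)
    refine (Measure.ae_prod_iff_ae_ae hms).2 ?_
    filter_upwards [hne μ] with x hx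
    filter_upwards [hne ν] with y hy using hdiam i x y hx hy
  -- The leftover ρ carries exactly the mass not matched by the bumps, and there the bound m ≤ 1
  -- suffices.
  obtain ⟨ρ, hρ⟩ := exists_coupling_of_le (μ := μ) (ν := ν) (γ := ∑ i, γ i)
    (by rw [fst_finset_sum]; exact (Finset.sum_le_sum fun i _ => hfst i).trans (hdens μ))
    (by rw [snd_finset_sum]; exact (Finset.sum_le_sum fun i _ => hsnd i).trans (hdens ν))
  refine (transportCost_le_integral hm hρ).trans ?_
  have hprob := hρ.1
  have hγu : (∑ i, γ i) Set.univ = ∑ i, min (p i) (q i) := by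
    rw [Measure.finsetSum_apply]
    exact Finset.sum_congr rfl fun i _ => hmass i
  have htot : ∑ i, min (p i) (q i) + ρ Set.univ = 1 := by
    rw [← hγu, ← Measure.add_apply, measure_univ]
  have hγfin : IsFiniteMeasure (∑ i, γ i) :=
    isFiniteMeasure_of_le (∑ i, γ i + ρ) (Measure.le_add_right le_rfl)
  have hρfin : IsFiniteMeasure ρ :=
    isFiniteMeasure_of_le (∑ i, γ i + ρ) (Measure.le_add_left le_rfl)
  have hS : ∑ i, min (p i) (q i) ≠ ∞ :=
    ne_top_of_le_ne_top ENNReal.one_ne_top (htot ▸ le_self_add)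
  have hρu : ρ Set.univ = 1 - ∑ i, min (p i) (q i) := by
    rw [← htot, ENNReal.add_sub_cancel_left hS]
  rw [integral_add_measure (hm.integrable hmeas _ measurable_fst measurable_snd)
    (hm.integrable hmeas _ measurable_fst measurable_snd)]
  refine add_le_add ?_ ?_
  · have hae : ∀ᵐ z ∂(∑ i, γ i), m z.1 z.2 ≤ ε := by
      rw [← Measure.sum_fintype, Measure.ae_sum_iff]
      exact hdiam'
    refine (integral_mono_ae (hm.integrable hmeas _ measurable_fst measurable_snd)
      (integrable_const ε) hae).trans ?_
    rw [integral_const, smul_eq_mul]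
    refine mul_le_of_le_one_left hε ?_
    rw [Measure.real, hγu]
    exact ENNReal.toReal_le_of_le_ofReal zero_le_one (by simpa using htot ▸ le_self_add)
  · refine (integral_mono (hm.integrable hmeas _ measurable_fst measurable_snd)
      (integrable_const (1 : ℝ)) fun z => hm.le_one z.1 z.2).trans ?_
    rw [integral_const, smul_eq_mul, mul_one, Measure.real, hρu]

end TransportCost

/-! ### Joint continuity of the semigroup in time and space. -/

namespace FellerDynkinSemigroup

section Continuity

variable {E : Type*} [TopologicalSpace E]

theorem op_apply_le (S : FellerDynkinSemigroup E) (t : ℝ≥0) {f : C₀(E, ℝ)} {M : ℝ} (hM : 0 < M)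
    (hf0 : ∀ x, 0 ≤ f x) (hf : ∀ x, f x ≤ M) (x : E) : S.op t f x ≤ M := by
  have h := (S.sub_markov t (M⁻¹ • f) (fun y => by
    simp only [ZeroAtInftyContinuousMap.smul_apply, smul_eq_mul]
    exact ⟨mul_nonneg (by positivity) (hf0 y), by
      rw [inv_mul_le_iff₀ hM, mul_one]; exact hf y⟩) x).2
  rwa [map_smul, ZeroAtInftyContinuousMap.smul_apply, smul_eq_mul, inv_mul_le_iff₀ hM,
    mul_one] at h

/-- The positive part of a function vanishing at infinity. -/
def posPart (f : C₀(E, ℝ)) : C₀(E, ℝ) where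
  toFun x := max (f x) 0
  continuous_toFun := (map_continuous f).max continuous_const
  zero_at_infty' := by
    have h := (zero_at_infty f).max (tendsto_const_nhds (x := (0 : ℝ)))
    rwa [max_self] at h

theorem posPart_apply (f : C₀(E, ℝ)) (x : E) : posPart f x = max (f x) 0 := rfl

/-- The positive and negative parts of f are sent into [0, ‖f‖], and two numbers in that interval
differ by at most ‖f‖. -/
theorem norm_op_apply_le (S : FellerDynkinSemigroup E) (t : ℝ≥0) (f : C₀(E, ℝ)) :
    ‖S.op t f‖ ≤ ‖f‖ := by
  rcases (norm_nonneg f).eq_or_lt with h0 | hpos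
  · have : f = 0 := norm_eq_zero.1 h0.symm
    simp [this]
  have habs : ∀ y, |f y| ≤ ‖f‖ := fun y => f.toBCF.norm_coe_le_norm y
  have hdec : f = posPart f - posPart (-f) := by
    ext y
    simp only [ZeroAtInftyContinuousMap.sub_apply, posPart_apply, ZeroAtInftyContinuousMap.neg_apply]
    rcases le_total (f y) 0 with h | h <;> simp [h]
  have h1 : ∀ g : C₀(E, ℝ), (∀ y, g y ≤ ‖f‖) → ∀ y, 0 ≤ S.op t (posPart g) y ∧
      S.op t (posPart g) y ≤ ‖f‖ := fun g hg y =>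
    ⟨S.op_nonneg t _ (fun z => le_max_right _ _) y,
      S.op_apply_le t hpos (fun z => le_max_right _ _) (fun z => max_le (hg z) hpos.le) y⟩
  rw [← ZeroAtInftyContinuousMap.norm_toBCF_eq_norm,
    BoundedContinuousFunction.norm_le (norm_nonneg f)]
  intro y
  have hp := h1 f (fun z => (le_abs_self _).trans (habs z)) y
  have hn := h1 (-f) (fun z => (neg_le_abs _).trans (habs z)) y
  change |S.op t f y| ≤ ‖f‖
  have : S.op t f y = S.op t (posPart f) y - S.op t (posPart (-f)) y := by
    conv_lhs => rw [hdec, map_sub, ZeroAtInftyContinuousMap.sub_apply]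
  rw [this, abs_le]
  constructor <;> linarith

/-- The semigroup law and contractivity bound the increment from s to t by the increment from 0 to t
- s. Right continuity at 0 thus gives two-sided continuity everywhere. -/
theorem continuous_op (S : FellerDynkinSemigroup E) (f : C₀(E, ℝ)) :
    Continuous fun t => S.op t f := by
  have key : ∀ s t : ℝ≥0, s ≤ t → ‖S.op t f - S.op s f‖ ≤ ‖S.op (t - s) f - f‖ := by
    intro s t hst
    have : S.op t f - S.op s f = S.op s (S.op (t - s) f - f) := by
      conv_lhs => rw [← add_tsub_cancel_of_le hst, S.op_add]
      rw [map_sub]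
      rfl
    rw [this]
    exact S.norm_op_apply_le s _
  rw [Metric.continuous_iff]
  intro t₀ ε hε
  have h := (S.strongly_continuous f).eventually (gt_mem_nhds hε)
  rw [eventually_nhdsWithin_iff, Metric.eventually_nhds_iff] at h
  obtain ⟨δ, hδ, h⟩ := h
  have small : ∀ s t : ℝ≥0, s ≤ t → dist s t < δ → ‖S.op t f - S.op s f‖ < ε := by
    intro s t hst hd
    rcases hst.eq_or_lt with rfl | hlt
    · simpa using hε
    refine (key s t hst).trans_lt (h ?_ (tsub_pos_of_lt hlt))
    rw [NNReal.dist_eq] at hd ⊢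
    rw [NNReal.coe_sub hst, NNReal.coe_zero, sub_zero, abs_sub_comm]
    exact hd
  refine ⟨δ, hδ, fun t ht => ?_⟩
  rcases le_total t t₀ with hle | hle
  · rw [dist_comm, dist_eq_norm]
    exact small _ _ hle ht
  · rw [dist_eq_norm]
    exact small _ _ hle (by rwa [dist_comm])

theorem continuous_op_apply (S : FellerDynkinSemigroup E) (f : C₀(E, ℝ)) :
    Continuous fun p : ℝ≥0 × E => S.op p.1 f p.2 := by
  have h : Continuous fun p : ℝ≥0 × E => ((S.op p.1 f).toBCF, p.2) :=
    (ZeroAtInftyContinuousMap.isometry_toBCF.continuous.comp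
      ((S.continuous_op f).comp continuous_fst)).prodMk continuous_snd
  exact h.fst.eval h.snd

end Continuity

section Kernel

variable {E : Type*} [TopologicalSpace E] [T2Space E] [LocallyCompactSpace E]
  [SecondCountableTopology E] [MeasurableSpace E] [BorelSpace E]

theorem integral_kernel (S : FellerDynkinSemigroup E) (t : ℝ≥0) (x : E) (f : C_c(E, ℝ)) :
    ∫ y, f y ∂(S.kernel t x) = S.op t (f : C₀(E, ℝ)) x :=
  RealRMK.integral_rieszMeasure (S.functional t x) f

theorem continuous_integral_kernel (S : FellerDynkinSemigroup E) (f : C_c(E, ℝ))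
    {X : Type*} [TopologicalSpace X] {u : X → ℝ≥0} {v : X → E} (hu : Continuous u)
    (hv : Continuous v) : Continuous fun z => ∫ y, f y ∂(S.kernel (u z) (v z)) := by
  simp_rw [integral_kernel]
  exact (S.continuous_op_apply f).comp (hu.prodMk hv)

theorem kernel_zero_apply (S : FellerDynkinSemigroup E) (x : E) :
    S.kernel 0 x = Measure.dirac x := by
  have h1 : (S.kernel 0 x).Regular := RealRMK.regular_rieszMeasure (S.functional 0 x)
  refine Measure.ext_of_integral_eq_on_compactlySupported fun f => ?_
  rw [integral_kernel, S.op_zero, integral_dirac]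
  rfl

end Kernel

end FellerDynkinSemigroup

/-! ### Local smallness of the transport cost along the semigroup. -/

theorem IsDiffusion.isProbabilityMeasure {E : Type*} [TopologicalSpace E] [T2Space E]
    [LocallyCompactSpace E] [SecondCountableTopology E] [MeasurableSpace E] [BorelSpace E]
    {S : FellerDynkinSemigroup E} (hS : IsDiffusion S) (t : ℝ≥0) (x : E) :
    IsProbabilityMeasure (S.kernel t x) :=
  ⟨hS.honest t x⟩

theorem IsLscPseudometric.measurable {E : Type*} [TopologicalSpace E] [SecondCountableTopology E]
    [MeasurableSpace E] [BorelSpace E] {m : E → E → ℝ} (hm : IsLscPseudometric m) :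
    Measurable fun p : E × E => m p.1 p.2 :=
  hm.2.measurable

theorem IsContinuousPseudometric.isLscPseudometric {E : Type*} [TopologicalSpace E]
    {m : E → E → ℝ} (hm : IsContinuousPseudometric m) : IsLscPseudometric m :=
  ⟨hm.1, hm.2.lowerSemicontinuous⟩

/-- Continuity of m makes its balls open, so finitely many of radius ε / 2 cover K; a subordinate
partition of unity with compact supports provides the bumps. -/
theorem IsContinuousPseudometric.exists_bumps {E : Type*} [TopologicalSpace E] [T2Space E]
    [LocallyCompactSpace E] {m : E → E → ℝ} (hm : IsContinuousPseudometric m) {K : Set E}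
    (hK : IsCompact K) {ε : ℝ} (hε : 0 < ε) :
    ∃ (s : Finset E) (g : s → C_c(E, ℝ)), (∀ i x, 0 ≤ g i x) ∧ (∀ x, ∑ i, g i x ≤ 1) ∧
      (∀ x ∈ K, ∑ i, g i x = 1) ∧ ∀ i x y, g i x ≠ 0 → g i y ≠ 0 → m x y ≤ ε := by
  let U : E → Set E := fun x => {y | m x y < ε / 2}
  have hU : ∀ x, IsOpen (U x) := fun x =>
    isOpen_lt (hm.2.comp (Continuous.prodMk_right x)) continuous_const
  obtain ⟨s, -, hs⟩ := hK.elim_nhds_subcover U fun x _ =>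
    (hU x).mem_nhds (by simp only [U, Set.mem_ofPred_eq, hm.1.self]; linarith)
  obtain ⟨f, hfU, hfc⟩ := PartitionOfUnity.exists_isSubordinate_of_locallyFinite_t2space hK
    (fun x : s => U x) (fun x => hU x) (locallyFinite_of_finite _)
    (by rwa [Set.iUnion_subtype])
  refine ⟨s, fun i => ⟨f i, hfc i⟩, fun i x => f.nonneg i x, fun x => ?_, fun x hx => ?_,
    fun i x y hx hy => ?_⟩
  · refine le_of_eq_of_le ?_ (f.sum_le_one x)
    rw [finsum_eq_sum_of_fintype]
    rfl
  · rw [← f.sum_eq_one hx, finsum_eq_sum_of_fintype]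
    rfl
  · have hmem : ∀ w, f i w ≠ 0 → m i w < ε / 2 := fun w hw => hfU i (subset_tsupport _ hw)
    have := hm.1.triangle x i y
    rw [hm.1.symm x i] at this
    linarith [hmem x hx, hmem y hy]

section Discounted

variable {E : Type*} [TopologicalSpace E] [T2Space E] [LocallyCompactSpace E]
  [SecondCountableTopology E] [MeasurableSpace E] [BorelSpace E] {m : E → E → ℝ}

theorem integrable_compactlySupported (g : C_c(E, ℝ)) (μ : Measure E) [IsFiniteMeasure μ] :
    Integrable g μ :=
  (map_continuous g).integrable_of_hasCompactSupport g.hasCompactSupport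

/-- Restates the bump bound through real integrals of compactly supported functions, the quantities
on which the Feller property gives continuity. -/
theorem transportCost_le_of_compactlySupported_bumps (hm : IsOneBoundedPseudometric m)
    (hmeas : Measurable fun p : E × E => m p.1 p.2) (μ ν : Measure E) [IsProbabilityMeasure μ]
    [IsProbabilityMeasure ν] {ι : Type*} [Fintype ι] (g : ι → C_c(E, ℝ))
    (hg0 : ∀ i x, 0 ≤ g i x) (hsum : ∀ x, ∑ i, g i x ≤ 1) {ε : ℝ} (hε : 0 ≤ ε)
    (hdiam : ∀ i x y, g i x ≠ 0 → g i y ≠ 0 → m x y ≤ ε) :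
    transportCost m μ ν ≤
      ε + max (1 - ∑ i, min (∫ y, g i y ∂μ) (∫ y, g i y ∂ν)) 0 := by
  have hpos : ∀ i, 0 ≤ min (∫ y, g i y ∂μ) (∫ y, g i y ∂ν) := fun i =>
    le_min (integral_nonneg (hg0 i)) (integral_nonneg (hg0 i))
  have hne : ∀ i w, ENNReal.ofReal (g i w) ≠ 0 → g i w ≠ 0 := fun i w hw h0 => hw (by simp [h0])
  have hb := transportCost_le_of_bumps hm hmeas μ ν (f := fun i y => ENNReal.ofReal (g i y))
    (fun i => (map_continuous (g i)).measurable.ennreal_ofReal)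
    (fun x => by
      rw [← ENNReal.ofReal_sum_of_nonneg fun i _ => hg0 i x]
      exact ENNReal.ofReal_le_one.2 (hsum x))
    hε (fun i x y hx hy => hdiam i x y (hne i x hx) (hne i y hy))
  have hmin : ∑ i, min (∫⁻ y, ENNReal.ofReal (g i y) ∂μ) (∫⁻ y, ENNReal.ofReal (g i y) ∂ν) =
      ENNReal.ofReal (∑ i, min (∫ y, g i y ∂μ) (∫ y, g i y ∂ν)) := by
    rw [ENNReal.ofReal_sum_of_nonneg fun i _ => hpos i]
    refine Finset.sum_congr rfl fun i _ => ?_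
    rw [ENNReal.ofReal_min,
      ofReal_integral_eq_lintegral_ofReal (integrable_compactlySupported _ μ) (ae_of_all _ (hg0 i)),
      ofReal_integral_eq_lintegral_ofReal (integrable_compactlySupported _ ν) (ae_of_all _ (hg0 i))]
  rwa [hmin, ← ENNReal.ofReal_one, ← ENNReal.ofReal_sub _ (Finset.sum_nonneg fun i _ => hpos i),
    ENNReal.toReal_ofReal'] at hb

/-- With bumps fixed at (x₀, t₀), the overlap `G` is jointly continuous. At the base point the two
measures coincide, so `G` there is at least the mass of K. Half of ε pays for the bump diameter,
half for the unmatched mass. Letting time vary too is what permits compactness in t later. -/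
theorem eventually_transportCost_kernel_lt {S : FellerDynkinSemigroup E} (hS : IsDiffusion S)
    (hm : IsContinuousPseudometric m) (x₀ : E) (t₀ : ℝ≥0) {ε : ℝ} (hε : 0 < ε) :
    ∀ᶠ z : E × ℝ≥0 in 𝓝 (x₀, t₀),
      transportCost m (S.kernel z.2 x₀) (S.kernel z.2 z.1) < ε := by
  have hprob := hS.isProbabilityMeasure
  obtain ⟨K, -, hK, hKμ⟩ : ∃ K ⊆ Set.univ, IsCompact K ∧
      ENNReal.ofReal (1 - ε / 2) < S.kernel t₀ x₀ K := by
    refine isOpen_univ.exists_lt_isCompact ?_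
    rw [measure_univ, ← ENNReal.ofReal_one, ENNReal.ofReal_lt_ofReal_iff one_pos]
    linarith
  obtain ⟨s, g, hg0, hsum, hsumK, hdiam⟩ := hm.exists_bumps hK (half_pos hε)
  let G : E × ℝ≥0 → ℝ := fun z => ∑ i, min (∫ y, g i y ∂(S.kernel z.2 x₀))
    (∫ y, g i y ∂(S.kernel z.2 z.1))
  have hG : Continuous G := continuous_finsetSum _ fun i _ =>
    (S.continuous_integral_kernel (g i) continuous_snd continuous_const).min
      (S.continuous_integral_kernel (g i) continuous_snd continuous_fst)
  have hG0 : 1 - ε / 2 < G (x₀, t₀) := by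
    have h1 : G (x₀, t₀) = ∫ y, ∑ i, g i y ∂(S.kernel t₀ x₀) := by
      simp only [G, min_self]
      rw [integral_finsetSum _ fun i _ => integrable_compactlySupported _ _]
    refine lt_of_lt_of_le (b := (S.kernel t₀ x₀).real K) ?_ ?_
    · rw [← ofReal_measureReal, ENNReal.ofReal_lt_ofReal_iff'] at hKμ
      exact hKμ.1
    · rw [h1, ← integral_indicator_one hK.measurableSet]
      refine integral_mono ((integrable_const _).indicator hK.measurableSet)
        (integrable_finsetSum _ fun i _ => integrable_compactlySupported _ _) fun y => ?_
      by_cases hy : y ∈ K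
      · simpa [hy] using (hsumK y hy).ge
      · simpa [hy] using Finset.sum_nonneg fun i _ => hg0 i y
  filter_upwards [hG.continuousAt.eventually (lt_mem_nhds hG0)] with z hz
  refine (transportCost_le_of_compactlySupported_bumps hm.1 hm.isLscPseudometric.measurable
    (S.kernel z.2 x₀) (S.kernel z.2 z.1) g hg0 hsum (half_pos hε).le hdiam).trans_lt ?_
  have : max (1 - G z) 0 < ε / 2 := max_lt (by linarith) (half_pos hε)
  change ε / 2 + max (1 - G z) 0 < ε
  linarith

end Discounted

/-- By the triangle inequality, moving both arguments changes m by at most the sum of the two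
displacements measured by m. -/
theorem IsOneBoundedPseudometric.continuous {E : Type*} [TopologicalSpace E] {m : E → E → ℝ}
    (hm : IsOneBoundedPseudometric m)
    (h : ∀ x, ∀ ε > 0, ∀ᶠ y in 𝓝 x, m x y ≤ ε) : Continuous fun p : E × E => m p.1 p.2 := by
  rw [continuous_iff_continuousAt]
  rintro ⟨x, y⟩
  rw [ContinuousAt, Metric.tendsto_nhds]
  intro ε hε
  rw [nhds_prod_eq]
  filter_upwards [(h x (ε / 3) (by linarith)).prod_mk (h y (ε / 3) (by linarith))] with p hp
  rw [Real.dist_eq, abs_lt]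
  have h1 := hm.triangle p.1 x p.2
  have h2 := hm.triangle x y p.2
  have h3 := hm.triangle x p.1 y
  have h4 := hm.triangle p.1 p.2 y
  rw [hm.symm p.1 x] at h1
  rw [hm.symm p.2 y] at h4
  constructor <;> linarith [hp.1, hp.2]

/-! ### The discounted functional and its iterates. -/

section Discounted

variable {E : Type*} [TopologicalSpace E] [T2Space E] [LocallyCompactSpace E]
  [SecondCountableTopology E] [MeasurableSpace E] [BorelSpace E] {m : E → E → ℝ}
  {S : FellerDynkinSemigroup E} {c : ℝ}

theorem discounted_nonneg (hm : IsOneBoundedPseudometric m) (hc0 : 0 < c) (x y : E) (t : ℝ≥0) :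
    0 ≤ c ^ (t : ℝ) * transportCost m (S.kernel t x) (S.kernel t y) :=
  mul_nonneg (Real.rpow_nonneg hc0.le _) (transportCost_nonneg hm _ _)

theorem discounted_le_rpow (hS : IsDiffusion S) (hm : IsLscPseudometric m) (hc0 : 0 < c)
    (x y : E) (t : ℝ≥0) :
    c ^ (t : ℝ) * transportCost m (S.kernel t x) (S.kernel t y) ≤ c ^ (t : ℝ) := by
  have hprob := hS.isProbabilityMeasure
  exact mul_le_of_le_one_right (Real.rpow_nonneg hc0.le _)
    (transportCost_le_one hm.1 hm.measurable _ _)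

theorem discounted_le_transportCost (hm : IsOneBoundedPseudometric m) (hc0 : 0 < c) (hc1 : c < 1)
    (x y : E) (t : ℝ≥0) :
    c ^ (t : ℝ) * transportCost m (S.kernel t x) (S.kernel t y) ≤
      transportCost m (S.kernel t x) (S.kernel t y) :=
  mul_le_of_le_one_left (transportCost_nonneg hm _ _) (Real.rpow_le_one hc0.le hc1.le t.2)

theorem discounted_le_one (hS : IsDiffusion S) (hm : IsLscPseudometric m) (hc0 : 0 < c)
    (hc1 : c < 1) (x y : E) (t : ℝ≥0) :
    c ^ (t : ℝ) * transportCost m (S.kernel t x) (S.kernel t y) ≤ 1 :=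
  (discounted_le_rpow hS hm hc0 x y t).trans (Real.rpow_le_one hc0.le hc1.le t.2)

theorem le_discountedFunctional (hS : IsDiffusion S) (hm : IsLscPseudometric m) (hc0 : 0 < c)
    (hc1 : c < 1) (x y : E) (t : ℝ≥0) :
    c ^ (t : ℝ) * transportCost m (S.kernel t x) (S.kernel t y) ≤
      discountedFunctional S c m x y :=
  le_ciSup (f := fun t : ℝ≥0 => c ^ (t : ℝ) * transportCost m (S.kernel t x) (S.kernel t y))
    ⟨1, by rintro _ ⟨t, rfl⟩; exact discounted_le_one hS hm hc0 hc1 x y t⟩ t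

theorem discountedFunctional_le {x y : E} {a : ℝ}
    (h : ∀ t : ℝ≥0, c ^ (t : ℝ) * transportCost m (S.kernel t x) (S.kernel t y) ≤ a) :
    discountedFunctional S c m x y ≤ a :=
  ciSup_le h

theorem isOneBoundedPseudometric_discountedFunctional (hS : IsDiffusion S)
    (hm : IsLscPseudometric m) (hc0 : 0 < c) (hc1 : c < 1) :
    IsOneBoundedPseudometric (discountedFunctional S c m) := by
  have hprob := hS.isProbabilityMeasure
  have := standardBorelSpace_of_locallyCompact E
  have hpow : ∀ t : ℝ≥0, 0 ≤ c ^ (t : ℝ) := fun t => Real.rpow_nonneg hc0.le _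
  have hcomm : ∀ x y, discountedFunctional S c m x y ≤ discountedFunctional S c m y x :=
    fun x y => discountedFunctional_le fun t =>
      (mul_le_mul_of_nonneg_left (transportCost_comm_le hm.1 hm.measurable _ _) (hpow t)).trans
        (le_discountedFunctional hS hm hc0 hc1 y x t)
  refine ⟨fun x y => Real.iSup_nonneg fun t => discounted_nonneg hm.1 hc0 x y t,
    fun x y => discountedFunctional_le fun t => discounted_le_one hS hm hc0 hc1 x y t,
    fun x => ?_, fun x y => (hcomm x y).antisymm (hcomm y x), fun x y z => ?_⟩
  · simp [discountedFunctional, transportCost_self hm.1 hm.measurable]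
  · refine discountedFunctional_le fun t => ?_
    refine (mul_le_mul_of_nonneg_left (transportCost_triangle hm.1 hm.measurable _
      (S.kernel t y) _) (hpow t)).trans ?_
    rw [mul_add]
    exact add_le_add (le_discountedFunctional hS hm hc0 hc1 x y t)
      (le_discountedFunctional hS hm hc0 hc1 y z t)

theorem isContinuousPseudometric_discountedFunctional (hS : IsDiffusion S)
    (hm : IsContinuousPseudometric m) (hc0 : 0 < c) (hc1 : c < 1) :
    IsContinuousPseudometric (discountedFunctional S c m) := by
  have hF := isOneBoundedPseudometric_discountedFunctional hS hm.isLscPseudometric hc0 hc1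
  refine ⟨hF, hF.continuous fun x ε hε => ?_⟩
  have hlim : Tendsto (fun t : ℝ≥0 => c ^ (t : ℝ)) atTop (𝓝 0) :=
    (tendsto_rpow_atTop_of_base_lt_one c (by linarith) hc1).comp
      (NNReal.tendsto_coe_atTop.2 tendsto_id)
  -- Beyond T the discount alone is below ε, as the cost is at most 1; on [0, T] compactness turns
  -- the local estimates into one neighbourhood of x valid for all times.
  obtain ⟨T, hT⟩ := eventually_atTop.1 (hlim.eventually (gt_mem_nhds hε))
  have hcomp : ∀ᶠ y in 𝓝 x, ∀ t ∈ Set.Icc 0 T,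
      transportCost m (S.kernel t x) (S.kernel t y) < ε :=
    isCompact_Icc.eventually_forall_of_forall_eventually
      (P := fun y t => transportCost m (S.kernel t x) (S.kernel t y) < ε) fun t _ =>
        eventually_transportCost_kernel_lt hS hm x t hε
  filter_upwards [hcomp] with y hy
  refine discountedFunctional_le fun t => ?_
  rcases le_total t T with htT | htT
  · exact (discounted_le_transportCost hm.1 hc0 hc1 x y t).trans (hy t ⟨zero_le, htT⟩).le
  · exact (discounted_le_rpow hS hm.isLscPseudometric hc0 x y t).trans (hT t htT).le

theorem le_discountedFunctional_self (hS : IsDiffusion S) (hm : IsLscPseudometric m) (hc0 : 0 < c)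
    (hc1 : c < 1) (x y : E) : m x y ≤ discountedFunctional S c m x y := by
  refine le_trans ?_ (le_discountedFunctional hS hm hc0 hc1 x y 0)
  rw [S.kernel_zero_apply, S.kernel_zero_apply, NNReal.coe_zero, Real.rpow_zero, one_mul]
  exact le_transportCost_dirac x y

theorem isContinuousPseudometric_iterMetric (hS : IsDiffusion S) (obs : C(E, Set.Icc (0 : ℝ) 1))
    (hc0 : 0 < c) (hc1 : c < 1) (n : ℕ) : IsContinuousPseudometric (iterMetric S obs c n) := by
  induction n with
  | zero =>
    refine ⟨⟨fun x y => abs_nonneg _, fun x y => ?_, fun x => by simp [iterMetric],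
      fun x y => abs_sub_comm _ _, fun x y z => abs_sub_le _ _ _⟩, ?_⟩
    · rw [iterMetric, abs_le]
      constructor <;> linarith [(obs x).2.1, (obs x).2.2, (obs y).2.1, (obs y).2.2]
    · change Continuous fun p : E × E => |(obs p.1 : ℝ) - obs p.2|
      fun_prop
  | succ n ih => exact isContinuousPseudometric_discountedFunctional hS ih hc0 hc1

theorem monotone_iterMetric (hS : IsDiffusion S) (obs : C(E, Set.Icc (0 : ℝ) 1))
    (hc0 : 0 < c) (hc1 : c < 1) (x y : E) : Monotone fun n => iterMetric S obs c n x y :=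
  monotone_nat_of_le_succ fun n => le_discountedFunctional_self hS
    (isContinuousPseudometric_iterMetric hS obs hc0 hc1 n).isLscPseudometric hc0 hc1 x y

end Discounted

/-! ### Increasing suprema and compactness of couplings. -/

section Suprema

theorem isLscPseudometric_iSup {E : Type*} [TopologicalSpace E] {d : ℕ → E → E → ℝ}
    (hd : ∀ n, IsLscPseudometric (d n)) : IsLscPseudometric fun x y => ⨆ n, d n x y := by
  have hbdd : ∀ x y, BddAbove (Set.range fun n => d n x y) := fun x y =>
    ⟨1, by rintro _ ⟨n, rfl⟩; exact (hd n).1.le_one x y⟩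
  refine ⟨⟨fun x y => Real.iSup_nonneg fun n => (hd n).1.nonneg x y,
    fun x y => ciSup_le fun n => (hd n).1.le_one x y, fun x => ?_, fun x y => ?_,
    fun x y z => ?_⟩, lowerSemicontinuous_ciSup (fun p => hbdd p.1 p.2) fun n => (hd n).2⟩
  · simp [(hd _).1.self]
  · simp_rw [(hd _).1.symm x y]
  · exact ciSup_le fun n => ((hd n).1.triangle x y z).trans
      (add_le_add (le_ciSup (hbdd x y) n) (le_ciSup (hbdd y z) n))

/-- All couplings share the same two marginals, each tight by inner regularity, and tight marginals
force tightness on the product. -/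
theorem isTightMeasureSet_couplings {E : Type*} [TopologicalSpace E] [T2Space E]
    [LocallyCompactSpace E] [SecondCountableTopology E] [MeasurableSpace E] [BorelSpace E]
    (μ ν : Measure E) [IsFiniteMeasure μ] [IsFiniteMeasure ν] :
    IsTightMeasureSet (couplings μ ν) := by
  refine IsTightMeasureSet.prodMk ?_ ?_
  · refine (isTightMeasureSet_singleton_of_innerRegular (μ := μ)).subset ?_
    rintro _ ⟨γ, hγ, rfl⟩
    exact hγ.2.1
  · refine (isTightMeasureSet_singleton_of_innerRegular (μ := ν)).subset ?_
    rintro _ ⟨γ, hγ, rfl⟩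
    exact hγ.2.2

/-- Every sequence of couplings has a limit coupling along the hyperfilter. -/
theorem exists_tendsto_couplings {E : Type*} [TopologicalSpace E] [T2Space E]
    [LocallyCompactSpace E] [SecondCountableTopology E] [MeasurableSpace E] [BorelSpace E]
    {μ ν : Measure E} [IsProbabilityMeasure μ] [IsProbabilityMeasure ν]
    (γ : ℕ → ProbabilityMeasure (E × E)) (hγ : ∀ n, (γ n : Measure (E × E)) ∈ couplings μ ν) :
    ∃ ρ : ProbabilityMeasure (E × E), (ρ : Measure (E × E)) ∈ couplings μ ν ∧
      Tendsto γ (hyperfilter ℕ) (𝓝 ρ) := by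
  have htight : IsTightMeasureSet
      {((ρ : ProbabilityMeasure (E × E)) : Measure (E × E)) | ρ ∈ Set.range γ} := by
    refine (isTightMeasureSet_couplings μ ν).subset ?_
    rintro _ ⟨_, ⟨n, rfl⟩, rfl⟩
    exact hγ n
  -- Prokhorov's theorem gives compactness; an ultrafilter limit replaces the extraction of a
  -- subsequence.
  obtain ⟨ρ, -, hρ⟩ := (isCompact_closure_of_isTightMeasureSet htight).ultrafilter_le_nhds
    ((hyperfilter ℕ).map γ) (by
      rw [le_principal_iff]
      exact Filter.mem_map.2 (univ_mem' fun n => subset_closure ⟨n, rfl⟩))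
  have hlim : Tendsto γ (hyperfilter ℕ) (𝓝 ρ) := hρ
  refine ⟨ρ, ⟨inferInstance, ?_, ?_⟩, hlim⟩
  · have h := ProbabilityMeasure.tendsto_map_of_tendsto_of_continuous γ ρ hlim
      (continuous_fst (X := E) (Y := E))
    have hconst : ∀ n, (γ n).map continuous_fst.aemeasurable =
        (⟨μ, inferInstance⟩ : ProbabilityMeasure E) := fun n =>
      Subtype.ext (hγ n).2.1
    simp_rw [hconst] at h
    exact congrArg (fun τ : ProbabilityMeasure E => (τ : Measure E))
      (tendsto_nhds_unique h tendsto_const_nhds)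
  · have h := ProbabilityMeasure.tendsto_map_of_tendsto_of_continuous γ ρ hlim
      (continuous_snd (X := E) (Y := E))
    have hconst : ∀ n, (γ n).map continuous_snd.aemeasurable =
        (⟨ν, inferInstance⟩ : ProbabilityMeasure E) := fun n =>
      Subtype.ext (hγ n).2.2
    simp_rw [hconst] at h
    exact congrArg (fun τ : ProbabilityMeasure E => (τ : Measure E))
      (tendsto_nhds_unique h tendsto_const_nhds)

/-- The transport cost is continuous along increasing sequences of continuous pseudometrics. -/
theorem transportCost_iSup_le {E : Type*} [TopologicalSpace E] [T2Space E]
    [LocallyCompactSpace E] [SecondCountableTopology E] [MeasurableSpace E] [BorelSpace E]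
    {d : ℕ → E → E → ℝ} (hd : ∀ n, IsContinuousPseudometric (d n))
    (hmono : ∀ x y, Monotone fun n => d n x y) (μ ν : Measure E) [IsProbabilityMeasure μ]
    [IsProbabilityMeasure ν] {a : ℝ} (ha : ∀ n, transportCost (d n) μ ν ≤ a) :
    transportCost (fun x y => ⨆ n, d n x y) μ ν ≤ a := by
  have hsup := isLscPseudometric_iSup fun n => (hd n).isLscPseudometric
  have hbdd : ∀ x y, BddAbove (Set.range fun n => d n x y) := fun x y =>
    ⟨1, by rintro _ ⟨n, rfl⟩; exact (hd n).1.le_one x y⟩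
  -- Near-optimal couplings suffice, with an error vanishing in n, so attainment of the infimum is
  -- not needed.
  have hex : ∀ n : ℕ, ∃ γ ∈ couplings μ ν, ∫ p, d n p.1 p.2 ∂γ < a + 1 / ((n : ℝ) + 1) := fun n =>
    exists_coupling_integral_lt ((ha n).trans_lt (lt_add_of_pos_right a Nat.one_div_pos_of_nat))
  choose γ hγ hlt using hex
  obtain ⟨ρ, hρ, hlim⟩ := exists_tendsto_couplings (fun n => ⟨γ n, (hγ n).1⟩) hγ
  refine (transportCost_le_integral hsup.1 hρ).trans ?_
  have hint : ∀ (k : ℕ) (τ : Measure (E × E)) [IsProbabilityMeasure τ],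
      Integrable (fun p : E × E => d k p.1 p.2) τ := fun k τ _ =>
    (hd k).1.integrable (hd k).isLscPseudometric.measurable τ measurable_fst measurable_snd
  -- The index k stays fixed while n grows: `d k` is a legitimate test function for weak
  -- convergence, whereas the supremum is only lower semicontinuous.
  have hk : ∀ k, ∫ p, d k p.1 p.2 ∂(ρ : Measure (E × E)) ≤ a := by
    intro k
    let f : (E × E) →ᵇ ℝ := BoundedContinuousFunction.ofNormedAddCommGroup
      (fun p : E × E => d k p.1 p.2) (hd k).2 1 fun p => by
        rw [Real.norm_of_nonneg ((hd k).1.nonneg _ _)]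
        exact (hd k).1.le_one _ _
    have h1 := (ProbabilityMeasure.tendsto_iff_forall_integral_tendsto.1 hlim) f
    have h2 : Tendsto (fun n : ℕ => a + 1 / ((n : ℝ) + 1)) (hyperfilter ℕ) (𝓝 a) := by
      have := (tendsto_one_div_add_atTop_nhds_zero_nat (𝕜 := ℝ)).const_add a
      rw [add_zero] at this
      exact this.mono_left (Nat.cofinite_eq_atTop ▸ hyperfilter_le_cofinite)
    refine le_of_tendsto_of_tendsto h1 h2 ?_
    have hge : ∀ᶠ n in (hyperfilter ℕ : Filter ℕ), k ≤ n :=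
      (Nat.cofinite_eq_atTop ▸ hyperfilter_le_cofinite : (hyperfilter ℕ : Filter ℕ) ≤ atTop)
        (eventually_ge_atTop k)
    filter_upwards [hge] with n hn
    have := (hγ n).1
    exact (integral_mono (hint k (γ n)) (hint n (γ n)) fun p => hmono p.1 p.2 hn).trans (hlt n).le
  have hconv := integral_tendsto_of_tendsto_of_monotone (μ := (ρ : Measure (E × E)))
    (f := fun k (p : E × E) => d k p.1 p.2) (F := fun p => ⨆ n, d n p.1 p.2)
    (fun k => hint k _) (hsup.1.integrable hsup.measurable _ measurable_fst measurable_snd)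
    (ae_of_all _ fun p => hmono p.1 p.2)
    (ae_of_all _ fun p => tendsto_atTop_ciSup (hmono p.1 p.2) (hbdd p.1 p.2))
  exact le_of_tendsto' hconv hk

end Suprema

end BehaviouralMetric

/-! ### The fixpoint theorem. -/

open BehaviouralMetric in
theorem mainTheorem3 {E : Type*} [TopologicalSpace E] [T2Space E] [LocallyCompactSpace E]
    [SecondCountableTopology E] [MeasurableSpace E] [BorelSpace E]
    (S : BehaviouralMetric.FellerDynkinSemigroup E) (hS : BehaviouralMetric.IsDiffusion S)
    (obs : C(E, Set.Icc (0 : ℝ) 1)) (c : ℝ) (hc0 : 0 < c) (hc1 : c < 1) :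
    (∀ n : ℕ, BehaviouralMetric.IsContinuousPseudometric
      (BehaviouralMetric.iterMetric S obs c n)) ∧
    BehaviouralMetric.IsLscPseudometric (BehaviouralMetric.behaviouralMetric S obs c) ∧
    BehaviouralMetric.discountedFunctional S c (BehaviouralMetric.behaviouralMetric S obs c) =
      BehaviouralMetric.behaviouralMetric S obs c := by
  have hcont := isContinuousPseudometric_iterMetric hS obs hc0 hc1
  have hlsc : IsLscPseudometric (behaviouralMetric S obs c) :=
    isLscPseudometric_iSup fun n => (hcont n).isLscPseudometric
  have hbdd : ∀ x y, BddAbove (Set.range fun n => iterMetric S obs c n x y) := fun x y =>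
    ⟨1, by rintro _ ⟨n, rfl⟩; exact (hcont n).1.le_one x y⟩
  have hprob := hS.isProbabilityMeasure
  refine ⟨hcont, hlsc, funext₂ fun x y => le_antisymm ?_
    (le_discountedFunctional_self hS hlsc hc0 hc1 x y)⟩
  refine discountedFunctional_le fun t => ?_
  have hct : 0 < c ^ (t : ℝ) := Real.rpow_pos_of_pos hc0 _
  rw [← le_div_iff₀' hct]
  refine transportCost_iSup_le hcont (monotone_iterMetric hS obs hc0 hc1) _ _ fun n => ?_
  rw [le_div_iff₀' hct]
  -- The discounted cost for iterate n is one of the terms whose supremum is iterate n + 1.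
  exact (le_discountedFunctional hS (hcont n).isLscPseudometric hc0 hc1 x y t).trans
    (le_ciSup (hbdd x y) (n + 1))
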